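/- Let $A$ be a commutative ring with unit, $\mathcal C$ an $A$-linear abelian category (the Hom-sets are $A$-modules and composition is $A$-bilinear) and $S$ a finite set. For $a\in A$ and an object $y$ of $\mathcal C$ write $a_y:=a\cdot\mathrm{id}_y$. An $S$-cube $x$ in $\mathcal C$ is a contravariant functor from the power set $\mathcal P(S)$, ordered by inclusion, to $\mathcal C$. Write $x_T:=x(T)$, and for $t\in T$ let $d_T^t=d_T^{t,x}\colon x_T\to x_{T\smallsetminus\{t\}}$ be the boundary morphism $x(T\smallsetminus\{t\}\subset T)$. The cube $x$ is monic if $x(U\subset V)$ is a monomorphism for all $U\subset V\subset S$. For disjoint $U,V\subset S$, $x|_U^V$ is the $U$-cube $B\mapsto x_{B\cup V}$. For $k\in S$, $H_0^k(x)$ is the $S\smallsetminus\{k\}$-cube $T\mapsto\operatorname{coker}(d^k_{T\cup\{k\}}\colon x_{T\cup\{k\}}\to x_T)$. Admissibility is defined by recursion on $\#S$: every $\emptyset$-cube is admissible; for $\#S=1$, $x$ is admissible if it is monic; for $\#S>1$, $x$ is admissible if it is monic and $H_0^k(x)$ is admissible for every $k\in S$. A sequence $f_1,\dots,f_q$ in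 $A$ is $y$-regular, for an object $y$ of $\mathcal C$, if no $f_i$ is a unit, $(f_1)_y$ is a monomorphism, and $(f_{i+1})_{y/(f_1,\dots,f_i)}$ is a monomorphism for $1\le i\le q-1$, where $y/(f_1,\dots,f_i)$ is the cokernel of $y^{\oplus i}\to y$ with components $(f_j)_y$. A finite family in $A$ is a $y$-sequence if it is $y$-regular in every ordering. An adjugate of $x$ is a pair $\mathfrak A=(\mathfrak a,\mathfrak d^*)$ of families $\mathfrak a=\{a_s\}_{s\in S}$ in $A$ and $\mathfrak d^*=\{d_T^{t*}\colon x_{T\smallsetminus\{t\}}\to x_T\}_{T\subset S,\,t\in T}$ of morphisms in $\mathcal C$ such that * $d_T^td_T^{t*}=(a_t)_{x_{T\smallsetminus\{t\}}}$ and $d_T^{t*}d_T^t=(a_t)_{x_T}$ for all $T\subset S$ and $t\in T$; * $d_T^bd_T^{a*}=d_{T\smallsetminus\{b\}}^{a*}d_{T\smallsetminus\{a\}}^b$ for all $T\subset S$ and distinct $a,b\in T$. It is regular if $\mathfrak a$ is an $x_T$-sequence for every $T\subset S$. Write $U\ominus T:=(U\cup T)\smallsetminus(U\cap T)$. If $x$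 is monic and $\mathfrak A$ is an adjugate of $x$, then for $T\subset S$ let $x^{\mathfrak A,T}$ be the $S$-cube with vertices $x^{\mathfrak A,T}_U:=x_{U\ominus T}$ and boundary morphisms, for $u\in U\subset S$, $$d_U^{u,x^{\mathfrak A,T}}:=\begin{cases}d_{U\ominus T}^{u,x}&\text{if }u\in U\smallsetminus T,\\ d_{(U\ominus T)\cup\{u\}}^{u*}&\text{if }u\in U\cap T.\end{cases}$$ **Theorem.** Let $x$ be an $S$-cube in $\mathcal C$ which admits a regular adjugate $\mathfrak A=(\mathfrak a,\mathfrak d^*)$. Then: 1. $x$ is monic. In particular the cubes $x^{\mathfrak A,T}$, $T\subset S$, are defined; they form a patching family, that is, $x^{\mathfrak A,T}|_{S\smallsetminus\{t\}}^{\emptyset}=x^{\mathfrak A,T\smallsetminus\{t\}}|_{S\smallsetminus\{t\}}^{\{t\}}$ for all $T\subset S$ and $t\in T$. 2. $x^{\mathfrak A,T}$ is admissible for every $T\subset S$. In particular $x=x^{\mathfrak A,\emptyset}$ is admissible. -/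

import Mathlib

open CategoryTheory CategoryTheory.Limits Opposite
open scoped symmDiff

universe w v u u'

/-- An `S`-cube in a category `C`: a contravariant functor on the power set of `S`, ordered by
inclusion. -/
abbrev Cube (S : Type w) (C : Type u) [Category.{v} C] := (Set S)ᵒᵖ ⥤ C

namespace Cube

section Basic

variable {S : Type w} {C : Type u} [Category.{v} C]

/-- The vertex `x_T`. -/
abbrev vertex (x : Cube S C) (T : Set S) : C := x.obj (op T)

/-- The morphism `x(U ⊆ V) : x_V ⟶ x_U`. -/
abbrev res (x : Cube S C) {U V : Set S} (h : U ⊆ V) : x.vertex V ⟶ x.vertex U :=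
  x.map (homOfLE h).op

/-- The boundary morphism `d_T^t : x_T ⟶ x_{T ∖ {t}}` (used for `t ∈ T`). -/
abbrev d (x : Cube S C) (T : Set S) (t : S) : x.vertex T ⟶ x.vertex (T \ {t}) :=
  x.res Set.sdiff_subset

/-- A cube is monic if all its structure morphisms are monomorphisms. -/
def IsMonic (x : Cube S C) : Prop :=
  ∀ ⦃U V : Set S⦄ (h : U ⊆ V), Mono (x.res h)

/-- The order preserving map `𝒫(U) → 𝒫(S)`, `B ↦ B ∪ V`. -/
def inclFunctor (U V : Set S) : Set U ⥤ Set S where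
  obj B := Subtype.val '' B ∪ V
  map f := homOfLE (Set.union_subset_union_left V (Set.image_mono (leOfHom f)))

/-- The restriction `x|_U^V` of `x` to `U` along `V` (used for disjoint `U` and `V`): the `U`-cube
with vertices `B ↦ x_{B ∪ V}`. -/
def restrict (x : Cube S C) (U V : Set S) : Cube U C :=
  (inclFunctor U V).op ⋙ x

/-- The natural transformation `d^k` from the backside `k`-face `x|_{S ∖ {k}}^{{k}}` to the
frontside `k`-face `x|_{S ∖ {k}}^∅`, given at `T ⊆ S ∖ {k}` by the boundary morphism
`x_{T ∪ {k}} ⟶ x_T`. -/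
def faceHom (x : Cube S C) (k : S) : x.restrict {k}ᶜ {k} ⟶ x.restrict {k}ᶜ ∅ where
  app T := x.res (Set.union_subset_union_right (Subtype.val '' T.unop) (Set.empty_subset {k}))
  naturality T T' f := by
    dsimp [restrict]
    rw [← x.map_comp, ← x.map_comp]
    rfl

/-- The patching condition `x^T|_{S ∖ {t}}^∅ = x^{T ∖ {t}}|_{S ∖ {t}}^{{t}}` for a family of
cubes indexed by the subsets of `S`. -/
def IsPatchingFamily (y : Set S → Cube S C) : Prop :=
  ∀ (T : Set S) (t : S), t ∈ T →
    (y T).restrict {t}ᶜ ∅ = (y (T \ {t})).restrict {t}ᶜ {t}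

end Basic

section Admissible

variable {C : Type u} [Category.{v} C] [Abelian C]

/-- The `k`-direction `0`-th homology of an `S`-cube: the `S ∖ {k}`-cube with vertices
`T ↦ coker (x_{T ∪ {k}} ⟶ x_T)`. -/
noncomputable def H0 {S : Type w} (x : Cube S C) (k : S) : Cube ({k}ᶜ : Set S) C where
  obj T := cokernel ((x.faceHom k).app T)
  map f := cokernel.map _ _ ((x.restrict {k}ᶜ {k}).map f) ((x.restrict {k}ᶜ ∅).map f)
    ((x.faceHom k).naturality f).symm
  map_id T := by
    ext
    simp
  map_comp f g := by
    ext
    simp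

/-- Admissible cubes: `x` is monic and `H0 x k` is admissible for every `k`. The recursion
ends at the empty index set, where the condition on the `H0 x k` is vacuous and every cube is
monic; so for a one-element index set, admissible means monic. -/
inductive IsAdmissible : {S : Type w} → Cube S C → Prop
  | intro {S : Type w} (x : Cube S C) (monic : x.IsMonic)
      (h0 : ∀ k : S, IsAdmissible (x.H0 k)) : IsAdmissible x

end Admissible

end Cube

section RegularSequences

variable {A : Type u'} [CommRing A] {C : Type u} [Category.{v} C] [Abelian C] [Linear A C]

/-- The morphism `a_x = a • id_x`. -/
abbrev scal (a : A) (x : C) : x ⟶ x := a • 𝟙 x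

/-- The quotient `x / (f_0, …, f_{q-1})`, the cokernel of the morphism from the direct sum of `q`
copies of `x` to `x` with components `(f_i)_x`. -/
noncomputable def quotientBy {q : ℕ} (x : C) (f : Fin q → A) : C :=
  cokernel (Sigma.desc fun i : Fin q => scal (f i) x)

/-- `f_0, …, f_{q-1}` is an `x`-regular sequence: the `f_i` are non-units, `f_0` is a
monomorphism on `x`, and `f_i` is a monomorphism on `x / (f_0, …, f_{i-1})` for `0 < i < q`. -/
def IsRegularSeq {q : ℕ} (x : C) (f : Fin q → A) : Prop :=
  (∀ i, ¬ IsUnit (f i)) ∧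
  (∀ h : 0 < q, Mono (scal (f ⟨0, h⟩) x)) ∧
  ∀ i : Fin q, 0 < i.val →
    Mono (scal (f i) (quotientBy x fun j : Fin i.val => f (j.castLE i.isLt.le)))

/-- A finite family is an `x`-sequence if it is an `x`-regular sequence for every ordering of its
members. -/
def IsObjSeq {S : Type w} (x : C) (f : S → A) : Prop :=
  ∀ (q : ℕ) (e : Fin q ≃ S), IsRegularSeq x (f ∘ e)

end RegularSequences

/-- An adjugate `(𝔞, 𝔡*)` of an `S`-cube `x`. In `comm`, the two uses of `x.res` are the boundary
morphisms `d_T^t` and `d_{T ∖ {s}}^t`. -/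
structure Adjugate (A : Type u') [CommRing A] {S : Type w} {C : Type u} [Category.{v} C]
    [Preadditive C] [Linear A C] (x : Cube S C) where
  a : S → A
  dstar : ∀ (T : Set S) (t : S), t ∈ T → (x.vertex (T \ {t}) ⟶ x.vertex T)
  dstar_d : ∀ (T : Set S) (t : S) (ht : t ∈ T),
    dstar T t ht ≫ x.d T t = a t • 𝟙 (x.vertex (T \ {t}))
  d_dstar : ∀ (T : Set S) (t : S) (ht : t ∈ T),
    x.d T t ≫ dstar T t ht = a t • 𝟙 (x.vertex T)
  comm : ∀ (T : Set S) (s t : S) (hs : s ∈ T) (_ht : t ∈ T) (hst : s ≠ t),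
    dstar T s hs ≫ x.d T t =
      x.res (show (T \ {t}) \ {s} ⊆ T \ {s} from Set.sdiff_subset_sdiff_left Set.sdiff_subset) ≫
        dstar (T \ {t}) s ⟨hs, hst⟩

namespace Adjugate

section

variable {A : Type u'} [CommRing A] {S : Type w} {C : Type u} [Category.{v} C]

/-- An adjugate is regular if `𝔞` is an `x_T`-sequence for every `T`. -/
def IsRegular [Abelian C] [Linear A C] {x : Cube S C} (𝔄 : Adjugate A x) : Prop :=
  ∀ T : Set S, IsObjSeq (x.vertex T) 𝔄.a

variable [Preadditive C] [Linear A C] {x : Cube S C}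

theorem exists_lift [Finite S] (𝔄 : Adjugate A x) (P D : Set S) (hPD : Disjoint P D) :
    ∃ φ : x.vertex P ⟶ x.vertex (P ∪ D),
      φ ≫ x.res Set.subset_union_left = (∏ᶠ s ∈ D, 𝔄.a s) • 𝟙 (x.vertex P) := by
  induction D, Set.toFinite D using Set.Finite.induction_on with
  | empty =>
    refine ⟨x.res (by simp), ?_⟩
    rw [← x.map_comp]
    simp only [finprod_mem_empty, one_smul]
    exact x.map_id _
  | @insert t D ht _ ih =>
    obtain ⟨φ, hφ⟩ := ih (hPD.mono_right (Set.subset_insert t D))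
    have htP : t ∉ P := fun h => Set.disjoint_left.1 hPD h (Set.mem_insert t D)
    have e : (P ∪ insert t D) \ {t} ⊆ P ∪ D := by
      rintro s ⟨h | rfl | h, h'⟩
      · exact Or.inl h
      · exact absurd rfl h'
      · exact Or.inr h
    have e' : P ⊆ (P ∪ insert t D) \ {t} := fun s hs =>
      ⟨Or.inl hs, fun h => htP ((show s = t from h) ▸ hs)⟩
    refine ⟨φ ≫ x.res e ≫ 𝔄.dstar (P ∪ insert t D) t (Set.mem_union_right P (Set.mem_insert t D)), ?_⟩
    have h1 : x.res (show P ⊆ P ∪ insert t D from Set.subset_union_left) =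
        x.d (P ∪ insert t D) t ≫ x.res e' := by
      rw [← x.map_comp]; rfl
    have h2 : x.res e ≫ x.res e' = x.res Set.subset_union_left := by
      rw [← x.map_comp]; rfl
    rw [h1]
    simp only [Category.assoc]
    rw [reassoc_of% 𝔄.dstar_d, finprod_mem_insert _ ht (Set.toFinite D)]
    rw [Linear.smul_comp, Category.id_comp, Linear.comp_smul, Linear.comp_smul, h2, hφ, smul_smul]

/-- If `x` is monic, there is exactly one `m : x_P ⟶ x_Q` of this kind; it is the composite of
the boundary morphisms `d^s`, `s ∈ P ∖ Q`, and the morphisms `d^{s*}`, `s ∈ Q ∖ P`. -/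
theorem exists_mixed [Finite S] (𝔄 : Adjugate A x) (P Q : Set S) :
    ∃ m : x.vertex P ⟶ x.vertex Q, m ≫ x.res (Set.empty_subset Q) =
      (∏ᶠ s ∈ Q \ P, 𝔄.a s) • x.res (Set.empty_subset P) := by
  obtain ⟨φ, hφ⟩ := 𝔄.exists_lift (P ∩ Q) (Q \ P)
    (Set.disjoint_left.2 fun s hs hs' => hs'.2 hs.1)
  have e : Q ⊆ P ∩ Q ∪ Q \ P := fun s hs => by
    by_cases h : s ∈ P
    · exact Or.inl ⟨h, hs⟩
    · exact Or.inr ⟨hs, h⟩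
  refine ⟨x.res Set.inter_subset_left ≫ φ ≫ x.res e, ?_⟩
  have h1 : x.res e ≫ x.res (Set.empty_subset Q) =
      x.res (show P ∩ Q ⊆ P ∩ Q ∪ Q \ P from Set.subset_union_left) ≫
        x.res (Set.empty_subset _) := by
    rw [← x.map_comp, ← x.map_comp]; rfl
  simp only [Category.assoc]
  rw [h1, reassoc_of% hφ, Linear.smul_comp, Category.id_comp, Linear.comp_smul, ← x.map_comp]
  rfl

/-- The morphism `x_P ⟶ x_Q` composed of boundary morphisms and their adjugates. -/
noncomputable def mixed [Finite S] (𝔄 : Adjugate A x) (P Q : Set S) : x.vertex P ⟶ x.vertex Q :=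
  (𝔄.exists_mixed P Q).choose

theorem mixed_spec [Finite S] (𝔄 : Adjugate A x) (P Q : Set S) :
    𝔄.mixed P Q ≫ x.res (Set.empty_subset Q) =
      (∏ᶠ s ∈ Q \ P, 𝔄.a s) • x.res (Set.empty_subset P) :=
  (𝔄.exists_mixed P Q).choose_spec

theorem mixed_unique [Finite S] (𝔄 : Adjugate A x) (hx : x.IsMonic) {P Q : Set S}
    (m : x.vertex P ⟶ x.vertex Q)
    (hm : m ≫ x.res (Set.empty_subset Q) =
      (∏ᶠ s ∈ Q \ P, 𝔄.a s) • x.res (Set.empty_subset P)) : 𝔄.mixed P Q = m := by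
  have := hx (Set.empty_subset Q)
  rw [← cancel_mono (x.res (Set.empty_subset Q)), hm, mixed_spec]

/-- The cube `x^{𝔄,T}` of the patching family associated to the adjugate `𝔄` of a monic cube `x`:
its vertex at `U` is `x_{U ⊖ T}`, and its boundary morphisms are boundary morphisms of `x` in the
directions outside `T` and the morphisms `d^{u*}` in the directions `u ∈ T`; see
`patch_d_of_notMem` and `patch_d_of_mem`. -/
noncomputable def patch [Finite S] (𝔄 : Adjugate A x) (hx : x.IsMonic) (T : Set S) :
    Cube S C where
  obj U := x.vertex (U.unop ∆ T)
  map {V U} _ := 𝔄.mixed (V.unop ∆ T) (U.unop ∆ T)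
  map_id U := 𝔄.mixed_unique hx _ (by simp)
  map_comp {W V U} f g := 𝔄.mixed_unique hx _ (by
    have hVW : V.unop ⊆ W.unop := leOfHom f.unop
    have hUV : U.unop ⊆ V.unop := leOfHom g.unop
    rw [Category.assoc, mixed_spec, Linear.comp_smul, mixed_spec, smul_smul,
      ← finprod_mem_union _ (Set.toFinite _) (Set.toFinite _)]
    · congr 2
      funext s
      have hs : (s ∈ U.unop ∆ T \ V.unop ∆ T ∪ V.unop ∆ T \ W.unop ∆ T) ↔
          s ∈ U.unop ∆ T \ W.unop ∆ T := by
        have h1 := @hVW s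
        have h2 := @hUV s
        simp only [Set.mem_union, Set.mem_sdiff, Set.mem_symmDiff]
        tauto
      simp only [hs]
    · rw [Set.disjoint_left]
      intro s
      have h1 := @hVW s
      have h2 := @hUV s
      simp only [Set.mem_sdiff, Set.mem_symmDiff]
      tauto)

theorem diff_symmDiff_of_notMem {U T : Set S} {u : S} (hT : u ∉ T) :
    (U \ {u}) ∆ T = (U ∆ T) \ {u} := by
  ext s
  by_cases h : s = u
  · subst h; simp [Set.mem_symmDiff, hT]
  · simp [Set.mem_symmDiff, h]

theorem diff_symmDiff_of_mem {U T : Set S} {u : S} (hU : u ∈ U) (hT : u ∈ T) :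
    (U \ {u}) ∆ T = insert u (U ∆ T) := by
  ext s
  by_cases h : s = u
  · subst h; simp [Set.mem_symmDiff, hT]
  · simp [Set.mem_symmDiff, h]

theorem insert_symmDiff_diff {U T : Set S} {u : S} (hU : u ∈ U) (hT : u ∈ T) :
    insert u (U ∆ T) \ {u} = U ∆ T := by
  ext s
  by_cases h : s = u
  · subst h; simp [Set.mem_symmDiff, hT, hU]
  · simp [h]

/-- For `u ∈ U ∖ T` the boundary morphism of `x^{𝔄,T}` is `d_{U ⊖ T}^{u,x}`; the morphism
`x.res _` is an identity, up to the equality of sets `(U ∖ {u}) ⊖ T = (U ⊖ T) ∖ {u}`. -/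
theorem patch_d_of_notMem [Finite S] (𝔄 : Adjugate A x) (hx : x.IsMonic) {U T : Set S} {u : S}
    (_hU : u ∈ U) (hT : u ∉ T) :
    (𝔄.patch hx T).d U u = x.d (U ∆ T) u ≫ x.res (diff_symmDiff_of_notMem hT).subset := by
  refine 𝔄.mixed_unique hx _ ?_
  have h : ((U \ {u}) ∆ T) \ (U ∆ T) = ∅ := by
    rw [diff_symmDiff_of_notMem hT]
    exact Set.sdiff_eq_empty.2 Set.sdiff_subset
  dsimp only
  rw [h, finprod_mem_empty, one_smul, ← x.map_comp, ← x.map_comp]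
  rfl

/-- For `u ∈ U ∩ T` the boundary morphism of `x^{𝔄,T}` is `d_{(U ⊖ T) ∪ {u}}^{u*}`; the morphisms
`x.res _` are identities, up to the equalities of sets `((U ⊖ T) ∪ {u}) ∖ {u} = U ⊖ T` and
`(U ∖ {u}) ⊖ T = (U ⊖ T) ∪ {u}`. -/
theorem patch_d_of_mem [Finite S] (𝔄 : Adjugate A x) (hx : x.IsMonic) {U T : Set S} {u : S}
    (hU : u ∈ U) (hT : u ∈ T) :
    (𝔄.patch hx T).d U u = x.res (insert_symmDiff_diff hU hT).subset ≫
      𝔄.dstar (insert u (U ∆ T)) u (Set.mem_insert u _) ≫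
        x.res (diff_symmDiff_of_mem hU hT).subset := by
  refine 𝔄.mixed_unique hx _ ?_
  have h : ((U \ {u}) ∆ T) \ (U ∆ T) = {u} := by
    rw [diff_symmDiff_of_mem hU hT]
    ext s
    by_cases h : s = u
    · subst h; simp [Set.mem_symmDiff, hT, hU]
    · simp [h]
  have h1 : x.res (diff_symmDiff_of_mem hU hT).subset ≫ x.res (Set.empty_subset _) =
      x.d (insert u (U ∆ T)) u ≫ x.res (Set.empty_subset _) := by
    rw [← x.map_comp, ← x.map_comp]; rfl
  dsimp only
  simp only [Category.assoc]
  rw [h, finprod_mem_singleton, h1, reassoc_of% 𝔄.dstar_d, Linear.smul_comp, Category.id_comp,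
    Linear.comp_smul, ← x.map_comp]
  rfl

end

end Adjugate

/-! Both monicity and admissibility come from two properties of a cube: every boundary morphism `d`
in direction `t` has a morphism `m` backwards with both composites equal to `a t` (`HasLifts`), and
every enumeration without repetition of members of `a` is weakly regular on every vertex
(`IsRegularFamily`). The first composite being a monomorphism makes `d` one.

Both properties pass to `H0 k`. Lifts pass because, the cube being monic, they commute with the
boundaries in direction `k`. For regularity (`isWeaklyRegular_cokernel`), let `d : Y ⟶ X` and `m`
compose to `a` both ways. Then `coker m → X/a → coker d` and `coker d → Y/a → coker m` are short
exact. A next element is a monomorphism on `X/a` and `Y/a`, hence on their subobjects `coker m` and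
`coker d`; reducing modulo it keeps both sequences exact, so one can repeat. Induction on the
cardinality of `S` gives admissibility.

Each patched cube has the same vertices as `x` up to reindexing, and `d` and `d*` merely trade roles
in the directions in `T`, so the same criterion applies to it. -/

section Regularity

variable {A : Type u'} [CommRing A] {C : Type u} [Category.{v} C] [Abelian C] [Linear A C]

/-! ### Short exact sequences and reduction modulo a ring element -/

theorem scal_comp {X Y : C} (a : A) (f : X ⟶ Y) : scal a X ≫ f = f ≫ scal a Y := by simp

theorem comp_cokernel_π_eq_zero_iff {X Y : C} (f : X ⟶ Y) {Z : C} (y : Z ⟶ Y) :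
    y ≫ cokernel.π f = 0 ↔
      ∃ (Z' : C) (π : Z' ⟶ Z) (_ : Epi π) (x : Z' ⟶ X), π ≫ y = x ≫ f :=
  CokernelCofork.IsColimit.comp_π_eq_zero_iff_up_to_refinements (cokernelIsCokernel f) y

/-- The morphism `X / a ⟶ Y / a` induced by `X ⟶ Y`. -/
noncomputable abbrev modMap {X Y : C} (a : A) (f : X ⟶ Y) :
    cokernel (scal a X) ⟶ cokernel (scal a Y) :=
  cokernel.map _ _ f f (scal_comp a f)

theorem mono_scal_of_mono {X Y : C} (a : A) (f : X ⟶ Y) [Mono f] [Mono (scal a Y)] :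
    Mono (scal a X) :=
  have : Mono (scal a X ≫ f) := by rw [scal_comp]; infer_instance
  mono_of_mono (scal a X) f

/-- Reduction modulo `a` preserves short exact sequences whose quotient has no `a`-torsion. -/
theorem shortExact_modMap {X Y Z : C} (a : A) {f : X ⟶ Y} {g : Y ⟶ Z} {w : f ≫ g = 0}
    (h : (ShortComplex.mk f g w).ShortExact) [Mono (scal a Z)] :
    ∃ w' : modMap a f ≫ modMap a g = 0,
      (ShortComplex.mk (modMap a f) (modMap a g) w').ShortExact := by
  have w' : modMap a f ≫ modMap a g = 0 := by
    rw [← cancel_epi (cokernel.π _)]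
    simp [reassoc_of% w]
  have hf : Mono f := h.mono_f
  have hg : Epi g := h.epi_g
  refine ⟨w', ?_⟩
  have mono : Mono (modMap a f) := by
    rw [Preadditive.mono_iff_cancel_zero]
    intro W z hz
    obtain ⟨W₁, π₁, _, x, hx⟩ := surjective_up_to_refinements_of_epi (cokernel.π (scal a X)) z
    have h1 : (x ≫ f) ≫ cokernel.π (scal a Y) = 0 := by
      have := π₁ ≫= hz
      rw [reassoc_of% hx] at this
      simpa using this
    obtain ⟨W₂, π₂, _, y, hy⟩ := (comp_cokernel_π_eq_zero_iff _ _).1 h1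
    -- By `hy`, `a` times `y ≫ g` vanishes, and `Z` has no `a`-torsion.
    have h2 : y ≫ g = 0 := by
      rw [← cancel_mono (scal a Z)]
      have := hy =≫ g
      simp only [Category.assoc, w, comp_zero, scal_comp] at this
      rw [Category.assoc, ← this, zero_comp]
    obtain ⟨W₃, π₃, _, x', hx'⟩ := h.exact.exact_up_to_refinements y h2
    dsimp at x' hx'
    have h3 : π₃ ≫ π₂ ≫ x = x' ≫ scal a X := by
      rw [← cancel_mono f]
      simp only [Category.assoc, hy, scal_comp]
      rw [reassoc_of% hx']
    rw [← cancel_epi π₁, ← cancel_epi π₂, ← cancel_epi π₃, hx, reassoc_of% h3,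
      cokernel.condition]
    simp
  have epi : Epi (modMap a g) := by
    have : Epi (cokernel.π (scal a Y) ≫ modMap a g) := by
      rw [cokernel.π_desc]; infer_instance
    exact epi_of_epi (cokernel.π (scal a Y)) _
  refine { exact := ?_, mono_f := mono, epi_g := epi }
  rw [ShortComplex.exact_iff_exact_up_to_refinements]
  intro W z hz
  dsimp at z hz ⊢
  obtain ⟨W₁, π₁, _, y, hy⟩ := surjective_up_to_refinements_of_epi (cokernel.π (scal a Y)) z
  have h1 : (y ≫ g) ≫ cokernel.π (scal a Z) = 0 := by
    have := π₁ ≫= hz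
    rw [reassoc_of% hy] at this
    simpa using this
  obtain ⟨W₂, π₂, _, t, ht⟩ := (comp_cokernel_π_eq_zero_iff _ _).1 h1
  obtain ⟨W₃, π₃, _, y', hy'⟩ := surjective_up_to_refinements_of_epi g t
  -- Subtracting a multiple of `a` moves `y` into the kernel of `g` without changing its class
  -- modulo `a`.
  have h2 : (π₃ ≫ π₂ ≫ y - y' ≫ scal a Y) ≫ g = 0 := by
    simp only [Preadditive.sub_comp, Category.assoc, ht, scal_comp]
    rw [reassoc_of% hy', sub_self]
  obtain ⟨W₄, π₄, _, x, hx⟩ := h.exact.exact_up_to_refinements _ h2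
  dsimp at x hx
  refine ⟨W₄, π₄ ≫ π₃ ≫ π₂ ≫ π₁, inferInstance, x ≫ cokernel.π _, ?_⟩
  have h3 := hx =≫ cokernel.π (scal a Y)
  simp only [Category.assoc, Preadditive.comp_sub, Preadditive.sub_comp, cokernel.condition,
    comp_zero, sub_zero] at h3
  simp [hy, h3]

/-- If `g` is a monomorphism, then `0 ⟶ coker f ⟶ coker (f ≫ g) ⟶ coker g ⟶ 0` is exact. -/
theorem shortExact_cokernel_comp {X Y Z : C} {f : X ⟶ Y} {g : Y ⟶ Z} {h : X ⟶ Z}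
    (fac : f ≫ g = h) [Mono g] :
    ∃ w, (ShortComplex.mk (cokernel.map f h (𝟙 X) g (by simp [fac]))
      (cokernel.map h g f (𝟙 Z) (by simp [fac])) w).ShortExact := by
  subst fac
  refine ⟨by rw [← cancel_epi (cokernel.π _)]; simp, ?_⟩
  refine { exact := ?_, mono_f := ?_, epi_g := ?_ }
  · rw [ShortComplex.exact_iff_exact_up_to_refinements]
    intro W z hz
    dsimp at z hz ⊢
    obtain ⟨W₁, π₁, _, t, ht⟩ := surjective_up_to_refinements_of_epi (cokernel.π (f ≫ g)) z
    have h1 : t ≫ cokernel.π g = 0 := by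
      have := π₁ ≫= hz
      rw [reassoc_of% ht] at this
      simpa using this
    obtain ⟨W₂, π₂, _, y, hy⟩ := (comp_cokernel_π_eq_zero_iff _ _).1 h1
    refine ⟨W₂, π₂ ≫ π₁, inferInstance, y ≫ cokernel.π f, ?_⟩
    simp [ht, reassoc_of% hy]
  · dsimp
    rw [Preadditive.mono_iff_cancel_zero]
    intro W z hz
    obtain ⟨W₁, π₁, _, y, hy⟩ := surjective_up_to_refinements_of_epi (cokernel.π f) z
    have h1 : (y ≫ g) ≫ cokernel.π (f ≫ g) = 0 := by
      have := π₁ ≫= hz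
      rw [reassoc_of% hy] at this
      simpa using this
    obtain ⟨W₂, π₂, _, x, hx⟩ := (comp_cokernel_π_eq_zero_iff _ _).1 h1
    have h2 : π₂ ≫ y = x ≫ f := by
      rw [← cancel_mono g]; simpa using hx
    rw [← cancel_epi π₁, ← cancel_epi π₂, hy, reassoc_of% h2, cokernel.condition]
    simp
  · dsimp
    have : Epi (cokernel.π (f ≫ g) ≫ cokernel.map (f ≫ g) g f (𝟙 Z) (by simp)) := by
      rw [cokernel.π_desc]; infer_instance
    exact epi_of_epi (cokernel.π (f ≫ g)) _

/-! ### Weakly regular sequences. The non-unit condition plays no role and is dropped. -/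

/-- The iterated quotient of `X` by the members of a list. -/
noncomputable def iterQuot (X : C) : List A → C
  | [] => X
  | a :: l => iterQuot (cokernel (scal a X)) l

/-- Weakly regular sequences: each member is a monomorphism on the quotient by the preceding
ones, without the condition that the members are not units. -/
def IsWeaklyRegular (X : C) : List A → Prop
  | [] => True
  | a :: l => Mono (scal a X) ∧ IsWeaklyRegular (cokernel (scal a X)) l

theorem isWeaklyRegular_of_forall_mono (l : List A) (X : C)
    (h : ∀ l₁ a l₂, l = l₁ ++ a :: l₂ → Mono (scal a (iterQuot X l₁))) :
    IsWeaklyRegular X l := by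
  induction l generalizing X with
  | nil => trivial
  | cons b l ih =>
    exact ⟨h [] b l rfl, ih _ fun l₁ a l₂ e => h (b :: l₁) a l₂ (by rw [e]; rfl)⟩

theorem IsWeaklyRegular.of_append {X : C} {l l' : List A} (h : IsWeaklyRegular X (l ++ l')) :
    IsWeaklyRegular X l := by
  induction l generalizing X with
  | nil => trivial
  | cons b l ih => exact ⟨h.1, ih h.2⟩

/-- The iterated quotient of `X` by a list is the universal quotient killed by its members. -/
theorem exists_π_iterQuot (X : C) (l : List A) : ∃ p : X ⟶ iterQuot X l, Epi p ∧
    (∀ a ∈ l, scal a X ≫ p = 0) ∧ ∀ ⦃Z : C⦄ (g : X ⟶ Z), (∀ a ∈ l, scal a X ≫ g = 0) →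
      ∃ h : iterQuot X l ⟶ Z, p ≫ h = g := by
  induction l generalizing X with
  | nil =>
    exact ⟨𝟙 X, (inferInstance : Epi (𝟙 X)), fun _ h => absurd h List.not_mem_nil,
      fun Z g _ => ⟨g, Category.id_comp g⟩⟩
  | cons b l ih =>
    obtain ⟨p, _, hp, hp'⟩ := ih (cokernel (scal b X))
    change ∃ p : X ⟶ iterQuot (cokernel (scal b X)) l, Epi p ∧
      (∀ a ∈ b :: l, scal a X ≫ p = 0) ∧ ∀ ⦃Z : C⦄ (g : X ⟶ Z),
        (∀ a ∈ b :: l, scal a X ≫ g = 0) →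
          ∃ h : iterQuot (cokernel (scal b X)) l ⟶ Z, p ≫ h = g
    refine ⟨cokernel.π (scal b X) ≫ p, epi_comp _ _, fun a ha => ?_, fun Z g hg => ?_⟩
    · rcases List.mem_cons.1 ha with rfl | h
      · rw [cokernel.condition_assoc, zero_comp]
      · rw [← Category.assoc, scal_comp, Category.assoc, hp a h, comp_zero]
    · obtain ⟨h, hh⟩ := hp' (cokernel.desc _ g (hg b (by simp))) (by
        intro a ha
        rw [← cancel_epi (cokernel.π _), ← Category.assoc, ← scal_comp, Category.assoc,
          cokernel.π_desc, hg a (by simp [ha]), comp_zero])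
      exact ⟨h, by rw [Category.assoc, hh, cokernel.π_desc]⟩

/-- Both objects are the universal quotient of `X` killed by the same elements. One side of the
comparison suffices: it embeds `iterQuot X l` into `quotientBy X f`, and absence of torsion passes
to subobjects. -/
theorem mono_scal_iterQuot_of_mono_scal_quotientBy {q : ℕ} (X : C) (f : Fin q → A) (l : List A)
    (hl : ∀ a, a ∈ l ↔ ∃ i, f i = a) (a : A) (h : Mono (scal a (quotientBy X f))) :
    Mono (scal a (iterQuot X l)) := by
  let p : X ⟶ quotientBy X f := cokernel.π _
  have hp : ∀ i, scal (f i) X ≫ p = 0 := fun i => by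
    have h1 : Sigma.ι (fun _ : Fin q => X) i ≫ Sigma.desc (fun i : Fin q => scal (f i) X) ≫ p =
        0 := by
      refine (congrArg (Sigma.ι (fun _ : Fin q => X) i ≫ ·) (cokernel.condition _)).trans ?_
      exact comp_zero
    rwa [Sigma.ι_desc_assoc] at h1
  obtain ⟨π, _, hπ, hπ'⟩ := exists_π_iterQuot X l
  obtain ⟨φ, hφ⟩ := hπ' p fun b hb => by
    obtain ⟨i, rfl⟩ := (hl b).1 hb
    exact hp i
  let ψ : quotientBy X f ⟶ iterQuot X l := cokernel.desc _ π (by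
    refine Sigma.hom_ext _ _ fun i => ?_
    rw [Sigma.ι_desc_assoc, comp_zero]
    exact hπ _ ((hl _).2 ⟨i, rfl⟩))
  have e : φ ≫ ψ = 𝟙 _ := by
    rw [← cancel_epi π, reassoc_of% hφ, Category.comp_id]
    exact cokernel.π_desc _ _ _
  have : Mono φ := mono_of_mono_fac e
  exact mono_scal_of_mono a φ

theorem IsObjSeq.isWeaklyRegular {S : Type w} [Finite S] {X : C} {f : S → A}
    (h : IsObjSeq X f) {l : List S} (hl : l.Nodup) : IsWeaklyRegular X (l.map f) := by
  classical
  cases nonempty_fintype S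
  -- Regularity is given only for enumerations of all of `S`, so `l` is completed to one and then
  -- recovered as an initial segment.
  set l' := l ++ (Finset.univ.toList.filter (· ∉ l)) with hl'
  have nd : l'.Nodup := by
    refine List.Nodup.append hl ((Finset.nodup_toList _).filter _) ?_
    intro s hs hs'
    simp at hs'
    exact hs' hs
  have mem : ∀ s, s ∈ l' := fun s => by
    by_cases hs : s ∈ l <;> simp [hl', hs]
  suffices IsWeaklyRegular X (l'.map f) by
    rw [hl', List.map_append] at this
    exact this.of_append
  obtain ⟨-, h0, h1⟩ := h _ (nd.getEquivOfForallMemList _ mem)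
  refine isWeaklyRegular_of_forall_mono _ _ fun l₁ a l₂ e => ?_
  have hlen : l₁.length < l'.length := by
    have := congrArg List.length e
    simp at this ⊢
    omega
  have get : ∀ i (hi : i < l'.length), some (f l'[i]) = (l₁ ++ a :: l₂)[i]? := fun i hi => by
    rw [← e]; simp [hi]
  have ha : f l'[l₁.length] = a := by
    have := get _ hlen
    simpa using this
  rcases Nat.eq_zero_or_pos l₁.length with h | hpos
  · obtain rfl := List.length_eq_zero_iff.1 h
    have := h0 hlen
    rw [← ha]
    exact this
  · have := h1 ⟨_, hlen⟩ hpos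
    rw [← ha]
    refine mono_scal_iterQuot_of_mono_scal_quotientBy X _ l₁ (fun b => ?_) _ this
    have key : ∀ i (hi : i < l₁.length), f (l'[i]'(hi.trans hlen)) = l₁[i] := fun i hi => by
      have := get i (hi.trans hlen)
      rw [List.getElem?_append_left hi, List.getElem?_eq_getElem hi] at this
      exact Option.some.inj this
    rw [List.mem_iff_getElem]
    constructor
    · rintro ⟨i, hi, rfl⟩
      exact ⟨⟨i, hi⟩, key i hi⟩
    · rintro ⟨i, rfl⟩
      exact ⟨i, i.2, (key i i.2).symm⟩

/-! ### Weak regularity on cokernels -/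

/-- If two objects with a weakly regular sequence are extensions of each other's end terms, the
sequence is weakly regular on the end terms. -/
theorem isWeaklyRegular_of_shortExact (l : List A) {N M P Q : C} {i : N ⟶ P} {p : P ⟶ M}
    {j : M ⟶ Q} {q : Q ⟶ N} {w : i ≫ p = 0} {w' : j ≫ q = 0}
    (h : (ShortComplex.mk i p w).ShortExact) (h' : (ShortComplex.mk j q w').ShortExact)
    (hP : IsWeaklyRegular P l) (hQ : IsWeaklyRegular Q l) :
    IsWeaklyRegular N l ∧ IsWeaklyRegular M l := by
  induction l generalizing N M P Q with
  | nil => exact ⟨trivial, trivial⟩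
  | cons a l ih =>
    have : Mono i := h.mono_f
    have : Mono j := h'.mono_f
    have := hP.1
    have := hQ.1
    -- Each end term is a subobject in one sequence and the quotient in the other, so each sequence
    -- supplies the torsion-freeness that reduction of the other needs.
    have hN : Mono (scal a N) := mono_scal_of_mono a i
    have hM : Mono (scal a M) := mono_scal_of_mono a j
    obtain ⟨_, h₁⟩ := shortExact_modMap a h
    obtain ⟨_, h₁'⟩ := shortExact_modMap a h'
    obtain ⟨r, r'⟩ := ih h₁ h₁' hP.2 hQ.2
    exact ⟨⟨hN, r⟩, ⟨hM, r'⟩⟩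

theorem isWeaklyRegular_cokernel {X Y : C} {a : A} {l : List A} (d : Y ⟶ X) (m : X ⟶ Y)
    (hmd : m ≫ d = scal a X) (hdm : d ≫ m = scal a Y) (hX : IsWeaklyRegular X (a :: l))
    (hY : IsWeaklyRegular Y (a :: l)) : IsWeaklyRegular (cokernel d) l := by
  have := hX.1
  have := hY.1
  have : Mono m := mono_of_mono_fac hmd
  have : Mono d := mono_of_mono_fac hdm
  obtain ⟨_, h⟩ := shortExact_cokernel_comp hmd
  obtain ⟨_, h'⟩ := shortExact_cokernel_comp hdm
  exact (isWeaklyRegular_of_shortExact l h h' hX.2 hY.2).2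

end Regularity

/-! ### Cubes with lifts and regular families; the admissibility criterion -/

namespace Cube

section Basic

variable {S : Type w} {C : Type u} [Category.{v} C]

theorem res_comp_res (x : Cube S C) {U V W : Set S} (h : U ⊆ V) (h' : V ⊆ W) :
    x.res h' ≫ x.res h = x.res (h.trans h') :=
  (x.map_comp (homOfLE h').op (homOfLE h).op).symm

theorem vertex_congr (x : Cube S C) {U V : Set S} (h : U = V) : x.vertex U = x.vertex V := by
  rw [h]

theorem mono_res_of_forall_insert [Finite S] {x : Cube S C}
    (h : ∀ ⦃U : Set S⦄ ⦃t : S⦄, t ∉ U → Mono (x.res (Set.subset_insert t U))) : x.IsMonic := by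
  -- The auxiliary set `D` bounds the directions in which `U` and `V` differ; the induction factors
  -- out one direction at a time.
  suffices H : ∀ (D U V : Set S) (hUV : U ⊆ V), V ⊆ U ∪ D → Mono (x.res hUV) from
    fun U V hUV => H V U V hUV Set.subset_union_right
  intro D
  induction D, Set.toFinite D using Set.Finite.induction_on with
  | empty =>
    intro U V hUV hV
    obtain rfl : U = V := hUV.antisymm (by simpa using hV)
    have : x.res hUV = 𝟙 _ := x.map_id _
    rw [this]; infer_instance
  | @insert t D _ _ ih =>
    intro U V hUV hV
    by_cases ht : t ∈ V ∧ t ∉ U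
    · have h1 : insert t U ⊆ V := Set.insert_subset ht.1 hUV
      have := ih (insert t U) V h1 (by rw [Set.insert_union, ← Set.union_insert]; exact hV)
      have := h ht.2
      rw [← x.res_comp_res (Set.subset_insert t U) h1]
      infer_instance
    · refine ih U V hUV fun s hs => ?_
      rcases hV hs with h1 | rfl | h1
      · exact Or.inl h1
      · exact Or.inl (by tauto)
      · exact Or.inr h1

end Basic

section Abelian

variable {A : Type u'} [CommRing A] {C : Type u} [Category.{v} C] [Abelian C] [Linear A C]
  {S : Type w}

/-- The boundary morphisms of `x` in direction `t` have two-sided inverses up to `a t`. -/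
def HasLifts (x : Cube S C) (a : S → A) : Prop :=
  ∀ ⦃U V : Set S⦄ ⦃t : S⦄ (hUV : U ⊆ V), t ∉ U → V = insert t U →
    ∃ m : x.vertex U ⟶ x.vertex V, m ≫ x.res hUV = scal (a t) _ ∧ x.res hUV ≫ m = scal (a t) _

theorem HasLifts.isMonic [Finite S] {x : Cube S C} {a : S → A} (h : x.HasLifts a)
    (ha : ∀ T t, Mono (scal (a t) (x.vertex T))) : x.IsMonic :=
  mono_res_of_forall_insert fun U t ht => by
    obtain ⟨m, -, hm⟩ := h (Set.subset_insert t U) ht rfl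
    have := ha (insert t U) t
    exact mono_of_mono_fac hm

/-- Every enumeration of members of `a` is weakly regular on every vertex of `x`. -/
def IsRegularFamily (x : Cube S C) (a : S → A) : Prop :=
  ∀ (T : Set S) (l : List S), l.Nodup → IsWeaklyRegular (x.vertex T) (l.map a)

theorem IsRegularFamily.mono_scal {x : Cube S C} {a : S → A} (h : x.IsRegularFamily a)
    (T : Set S) (t : S) : Mono (scal (a t) (x.vertex T)) :=
  (h T [t] (List.nodup_singleton t)).1

theorem insert_image_union {k : S} (U : Set ({k}ᶜ : Set S)) (t : ({k}ᶜ : Set S)) (V : Set S) :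
    Subtype.val '' insert t U ∪ V = insert t.1 (Subtype.val '' U ∪ V) := by
  rw [Set.image_insert_eq, Set.insert_union]

theorem HasLifts.h0 {x : Cube S C} {a : S → A} (h : x.HasLifts a) (hx : x.IsMonic) (k : S) :
    (x.H0 k).HasLifts fun t => a t := by
  intro U V t hUV ht hV
  have sub (W : Set S) : Subtype.val '' U ∪ W ⊆ Subtype.val '' V ∪ W :=
    Set.union_subset_union_left W (Set.image_mono hUV)
  have lift (W : Set S) (hW : W ⊆ {k}) := h (sub W) (t := t.1)
    (by rintro (⟨s, hs, e⟩ | hs)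
        · exact ht (Subtype.ext e ▸ hs)
        · exact t.2 (hW hs))
    (by rw [hV, insert_image_union])
  obtain ⟨m₁, h₁, h₁'⟩ := lift {k} subset_rfl
  obtain ⟨m₀, h₀, h₀'⟩ := lift ∅ (Set.empty_subset _)
  have inc (U : Set ({k}ᶜ : Set S)) : Subtype.val '' U ∪ (∅ : Set S) ⊆ Subtype.val '' U ∪ {k} :=
    Set.union_subset_union_right _ (Set.empty_subset _)
  -- After the boundary monomorphism in direction `t`, both sides become `a t` times `x.res (inc
  -- U)`.
  have comm : x.res (inc U) ≫ m₀ = m₁ ≫ x.res (inc V) := by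
    have := hx (sub ∅)
    rw [← cancel_mono (x.res (sub ∅)), Category.assoc, h₀, Category.assoc, res_comp_res,
      ← x.res_comp_res (inc U) (sub {k}), reassoc_of% h₁, scal_comp]
  refine ⟨cokernel.map (x.res (inc U)) (x.res (inc V)) m₁ m₀ comm, ?_, ?_⟩
  · refine (cancel_epi (cokernel.π (x.res (inc U)))).1 ?_
    refine (cokernel.π_desc_assoc _ _ _ _).trans ?_
    refine (Category.assoc _ _ _).trans ?_
    refine (congrArg (m₀ ≫ ·) (cokernel.π_desc _ _ _)).trans ?_
    refine ((Category.assoc _ _ _).symm.trans (congrArg (· ≫ cokernel.π _) h₀)).trans ?_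
    exact scal_comp _ _
  · refine (cancel_epi (cokernel.π (x.res (inc V)))).1 ?_
    refine (cokernel.π_desc_assoc _ _ _ _).trans ?_
    refine (Category.assoc _ _ _).trans ?_
    refine (congrArg (x.res (sub ∅) ≫ ·) (cokernel.π_desc _ _ _)).trans ?_
    refine ((Category.assoc _ _ _).symm.trans (congrArg (· ≫ cokernel.π _) h₀')).trans ?_
    exact scal_comp _ _

theorem IsRegularFamily.h0 {x : Cube S C} {a : S → A} (h : x.IsRegularFamily a)
    (hx : x.HasLifts a) (k : S) : (x.H0 k).IsRegularFamily fun t => a t := by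
  intro T l hl
  have inc : Subtype.val '' T ∪ (∅ : Set S) ⊆ Subtype.val '' T ∪ {k} :=
    Set.union_subset_union_right _ (Set.empty_subset _)
  obtain ⟨m, hm, hm'⟩ := hx inc (t := k)
    (by rintro (⟨s, -, e⟩ | hs)
        · exact s.2 e
        · exact hs)
    (by rw [Set.union_empty, Set.union_singleton])
  -- With `k` placed first, `isWeaklyRegular_cokernel` consumes `a k` and leaves the rest of the
  -- list regular on the cokernel.
  have nd : (k :: l.map Subtype.val).Nodup :=
    List.nodup_cons.2 ⟨fun hk => by
      obtain ⟨s, -, e⟩ := List.mem_map.1 hk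
      exact s.2 e, hl.map Subtype.val_injective⟩
  have key := fun T => h T _ nd
  simp only [List.map_cons, List.map_map] at key
  exact isWeaklyRegular_cokernel (x.res inc) m hm hm' (key _) (key _)

theorem isAdmissible_of_hasLifts [Finite S] {x : Cube S C} {a : S → A} (h : x.HasLifts a)
    (h' : x.IsRegularFamily a) : x.IsAdmissible := by
  induction hn : Nat.card S generalizing S with
  | zero =>
    have : IsEmpty S := (Nat.card_eq_zero.1 hn).resolve_right (not_infinite_iff_finite.2 ‹_›).elim
    exact .intro x (h.isMonic h'.mono_scal) fun k => isEmptyElim k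
  | succ n ih =>
    have hx := h.isMonic h'.mono_scal
    refine .intro x hx fun k => ih (h.h0 hx k) (h'.h0 h k) ?_
    have := Set.ncard_add_ncard_compl ({k} : Set S)
    rw [Set.ncard_singleton, hn] at this
    rw [Nat.card_coe_set_eq]
    omega

end Abelian

end Cube

/-! ### The adjugate and its patching family -/

namespace Adjugate

open Cube

variable {A : Type u'} [CommRing A] {S : Type w} {C : Type u} [Category.{v} C]

variable [Abelian C] [Linear A C] {x : Cube S C}

theorem hasLifts (𝔄 : Adjugate A x) : x.HasLifts 𝔄.a := by
  rintro U V t hUV ht rfl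
  have key (W : Set S) (hW : W = insert t U \ {t}) (h : W ⊆ insert t U) :
      ∃ m : x.vertex W ⟶ x.vertex (insert t U),
        m ≫ x.res h = scal (𝔄.a t) _ ∧ x.res h ≫ m = scal (𝔄.a t) _ := by
    subst hW
    exact ⟨𝔄.dstar _ t (Set.mem_insert t U), 𝔄.dstar_d _ _ _, 𝔄.d_dstar _ _ _⟩
  exact key U (by rw [Set.insert_sdiff_self_of_notMem ht]) hUV

/-- The two scalars are the products over `Q \ P` and `P \ Q`, and together these sets are `{t}`.
This treats `d` followed by `d*` and `d*` followed by `d` at once. -/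
theorem mixed_comp_mixed [Finite S] (𝔄 : Adjugate A x) (hx : x.IsMonic) {P Q : Set S} {t : S}
    (h : P ∆ Q = {t}) : 𝔄.mixed P Q ≫ 𝔄.mixed Q P = scal (𝔄.a t) (x.vertex P) := by
  have := hx (Set.empty_subset P)
  rw [← cancel_mono (x.res (Set.empty_subset P)), Category.assoc, mixed_spec, Linear.comp_smul,
    mixed_spec, smul_smul, ← finprod_mem_union (disjoint_sdiff_sdiff) (Set.toFinite _)
    (Set.toFinite _)]
  have h' : P \ Q ∪ Q \ P = {t} := h
  rw [h', finprod_mem_singleton, Linear.smul_comp, Category.id_comp]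

theorem symmDiff_symmDiff_insert {U T : Set S} {t : S} (ht : t ∉ U) :
    (U ∆ T) ∆ (insert t U ∆ T) = {t} := by
  ext s
  by_cases h : s = t
  · subst h; simp [Set.mem_symmDiff, ht, em]
  · simp [Set.mem_symmDiff, h]; tauto

theorem hasLifts_patch [Finite S] (𝔄 : Adjugate A x) (hx : x.IsMonic) (T : Set S) :
    (𝔄.patch hx T).HasLifts 𝔄.a := by
  rintro U V t hUV ht rfl
  have h := symmDiff_symmDiff_insert (T := T) ht
  exact ⟨𝔄.mixed (U ∆ T) (insert t U ∆ T), 𝔄.mixed_comp_mixed hx h,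
    𝔄.mixed_comp_mixed hx (by rw [symmDiff_comm, h])⟩

/-- Symmetric differences agree only as propositional equalities of sets; this transports the
structure morphisms of patched cubes along them. -/
theorem mixed_eq_eqToHom_comp [Finite S] (𝔄 : Adjugate A x) {P P' Q Q' : Set S} (hP : P = P')
    (hQ : Q = Q') : 𝔄.mixed P Q = eqToHom (by rw [hP]) ≫ 𝔄.mixed P' Q' ≫ eqToHom (by rw [hQ]) := by
  subst hP hQ
  simp

theorem isPatchingFamily_patch [Finite S] (𝔄 : Adjugate A x) (hx : x.IsMonic) :
    IsPatchingFamily (𝔄.patch hx) := by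
  intro T t ht
  have e (B : Set ({t}ᶜ : Set S)) :
      (Subtype.val '' B ∪ ∅) ∆ T = (Subtype.val '' B ∪ {t}) ∆ (T \ {t}) := by
    have hB : t ∉ Subtype.val '' B := by
      rintro ⟨s, -, e⟩
      exact s.2 e
    ext s
    by_cases h : s = t
    · subst h; simp [Set.mem_symmDiff, hB, ht]
    · simp [Set.mem_symmDiff, h]
  exact CategoryTheory.Functor.ext (fun B => x.vertex_congr (e B.unop)) fun B B' f =>
    𝔄.mixed_eq_eqToHom_comp (e B.unop) (e B'.unop)

theorem mixed_eq_res [Finite S] (𝔄 : Adjugate A x) (hx : x.IsMonic) {P Q : Set S} (h : Q ⊆ P) :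
    𝔄.mixed P Q = x.res h :=
  𝔄.mixed_unique hx _ (by
    rw [Set.sdiff_eq_empty.2 h, finprod_mem_empty, one_smul, res_comp_res])

theorem patch_empty [Finite S] (𝔄 : Adjugate A x) (hx : x.IsMonic) : 𝔄.patch hx ∅ = x := by
  have e (U : Set S) : U ∆ ∅ = U := symmDiff_bot U
  refine CategoryTheory.Functor.ext (fun U => x.vertex_congr (e U.unop)) fun U V f => ?_
  refine (𝔄.mixed_eq_eqToHom_comp (e U.unop) (e V.unop)).trans ?_
  rw [𝔄.mixed_eq_res hx (leOfHom f.unop)]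
  rfl

theorem IsRegular.isRegularFamily [Finite S] {𝔄 : Adjugate A x} (h : 𝔄.IsRegular) :
    x.IsRegularFamily 𝔄.a :=
  fun T _ hl => (h T).isWeaklyRegular hl

end Adjugate

theorem theorem5p10 {A : Type u'} [CommRing A] {C : Type u} [Category.{v} C] [Abelian C]
    [Linear A C] {S : Type w} [Finite S] (x : Cube S C) (𝔄 : Adjugate A x)
    (h𝔄 : 𝔄.IsRegular) :
    ∃ hx : x.IsMonic,
      Cube.IsPatchingFamily (fun T => 𝔄.patch hx T) ∧
      (∀ T : Set S, Cube.IsAdmissible (𝔄.patch hx T)) ∧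
      𝔄.patch hx ∅ = x ∧
      Cube.IsAdmissible x := by
  have hreg := h𝔄.isRegularFamily
  have hx : x.IsMonic := 𝔄.hasLifts.isMonic hreg.mono_scal
  exact ⟨hx, 𝔄.isPatchingFamily_patch hx,
    fun T => Cube.isAdmissible_of_hasLifts (𝔄.hasLifts_patch hx T) fun U => hreg (U ∆ T),
    𝔄.patch_empty hx, Cube.isAdmissible_of_hasLifts 𝔄.hasLifts hreg⟩
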